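/- Let $Q$ denote the non-negative rationals. Reals are points of point-free spaces, i.e. models of propositional geometric theories, in an arbitrary topos; equivalently, they take truth values in an arbitrary frame $H$ (the subobjects of $1$; $H=\{\bot,\top\}$ gives ordinary subsets of $\mathbb{Q}$). All conditions below are read in $H$, with $\wedge,\vee,\exists$ as finite meets and joins and arbitrary joins. A non-negative lower real $x\in\overrightarrow{[0,\infty]}$ is a predicate $q<x$ on $q\in\mathbb{Q}$ with $q<x\Leftrightarrow\exists q'>q.\,(q'<x)$ that holds for all $q<0$. A non-negative upper real $x\in\overleftarrow{[0,\infty]}$ is a predicate $x<r$ on $r\in\mathbb{Q}$ with $x<r\Leftrightarrow\exists r'<r.\,(x<r')$ and such that $x<0$ is false. A non-negative Dedekind real $x\in[0,\infty)$ is a pair $(L_x,R_x)$ of a non-negative lower and a non-negative upper real, both inhabited, such that $q<x<r$ implies $q<r$ (separated), and $q<r$ implies $q<x$ or $x<r$ (located). For $s\in Q$ and a lower real $x$ write $s\prec x$ for $(s<x)\vee(s=0)$. For $a\in\mathbb{N}$ and a positive integer $b$, multiplication, natural powers, roots and $1$ are defined as follows, where $q,r$ range over $\mathbb{Q}$. On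 lower reals: - $q<xy\Leftrightarrow\exists s,t\in Q.\,(s\prec x\wedge t\prec y\wedge q<st)$; - $q<x^a\Leftrightarrow\exists s\in Q.\,(s\prec x\wedge q<s^a)$; - $q<x^{1/b}\Leftrightarrow q<0\vee(q\ge 0\wedge q^b<x)$; - $q<1$ as for rationals. On upper reals: - $xy<r\Leftrightarrow\exists s,t\in\mathbb{Q}.\,(x<s\wedge y<t\wedge st<r)$; - $x^a<r\Leftrightarrow\exists s\in\mathbb{Q},\,s>0.\,(x<s\wedge s^a<r)\ \vee\ (a=0\wedge 1<r)$; - $x^{1/b}<r\Leftrightarrow r>0\wedge x<r^b$; - $1<r$ as for rationals. On Dedekind reals all of these act separately on $L_x$ and $R_x$. **Proposition.** Let "non-negative real" mean any one of the three kinds: lower, upper, or Dedekind. 1. (Well-definedness) For every non-negative real $x$, all $a,c\in\mathbb{N}$ and all positive integers $b,d$ with $\frac ab=\frac cd$, we have $(x^a)^{1/b}=(x^c)^{1/d}$. Hence $x^q:=(x^a)^{1/b}$ is well defined for $q=\frac ab\in Q$. The construction $x\mapsto x^q$ is moreover a map of spaces: it commutes with transport of reals along any frame homomorphism $H\to K$.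 2. (Basic Equations) For all non-negative reals $x,y$ of the same kind and all $q,q'\in Q$, $$x^{q+q'}=x^q\,x^{q'},\quad x^0=1;\qquad x^{qq'}=(x^q)^{q'},\quad x^1=x;\qquad (xy)^q=x^q\,y^q,\quad 1^q=1 .$$ -/

import Mathlib

/-!
Non-negative reals as models of propositional geometric theories, over an arbitrary frame `H`
of truth values.  A relation on the set of rationals inside a topos is a family, indexed by `ℚ`,
of subobjects of `1`, that is, a function from `ℚ` to the frame `H` of subobjects of `1`.
Every frame arises in this way (sheaves on a locale), and `H = Prop` gives sets of rationals.
Conjunction, disjunction and existential quantification become `⊓`, `⊔` and `⨆`;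
a decidable condition `p` on rationals becomes the truth value `⨆ (_ : p), ⊤`.
-/

namespace PointFree

universe u v

/-- A non-negative lower real with truth values in `H` (`∞` included): `lt q` is the truth value
of `q < x`. -/
@[ext]
structure NNLower (H : Type u) [Order.Frame H] where
  lt : ℚ → H
  rounded : ∀ q, lt q = ⨆ (q' : ℚ) (_ : q < q'), lt q'
  nonneg : ∀ q, q < 0 → lt q = ⊤

/-- A non-negative upper real with truth values in `H` (`∞` included): `gt r` is the truth value
of `x < r`. -/
@[ext]
structure NNUpper (H : Type u) [Order.Frame H] where
  gt : ℚ → H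
  rounded : ∀ r, gt r = ⨆ (r' : ℚ) (_ : r' < r), gt r'
  nonneg : gt 0 = ⊥

/-- A non-negative Dedekind real with truth values in `H`: the pair of its left section (`lower`)
and its right section (`upper`). -/
@[ext]
structure NNDedekind (H : Type u) [Order.Frame H] where
  lower : NNLower H
  upper : NNUpper H
  left_inhabited : ⨆ q : ℚ, lower.lt q = ⊤
  right_inhabited : ⨆ r : ℚ, upper.gt r = ⊤
  separated : ∀ q r : ℚ, lower.lt q ⊓ upper.gt r ≤ ⨆ (_ : q < r), ⊤
  located : ∀ q r : ℚ, q < r → lower.lt q ⊔ upper.gt r = ⊤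

section LowerReals

variable {H : Type u} [Order.Frame H] {K : Type v} [Order.Frame K]

namespace NNLower

/-- The truth value of `s ≺ x`, for a non-negative rational `s`: as `<`, but with `0 ≺ x` for
every `x`.  Non-negative lower reals are the rounded ideals of the non-negative rationals
for the strict order modified to allow `0 < 0`. -/
def below (x : NNLower H) (s : ℚ) : H := x.lt s ⊔ ⨆ (_ : s = 0), ⊤

/-- Transport of a lower real along a frame homomorphism. -/
def map (f : FrameHom H K) (x : NNLower H) : NNLower K where
  lt q := f (x.lt q)
  rounded q := by
    conv_lhs => rw [x.rounded q]
    simp only [map_iSup]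
  nonneg q hq := by rw [x.nonneg q hq, map_top]

instance : One (NNLower H) where
  one :=
    { lt := fun q => ⨆ (_ : q < 1), ⊤
      rounded := by
        intro q
        apply le_antisymm
        · refine iSup_le fun h => ?_
          obtain ⟨q', h1, h2⟩ := exists_between h
          exact le_iSup_of_le q' (le_iSup_of_le h1 (le_iSup_of_le h2 le_rfl))
        · exact iSup_le fun q' => iSup_le fun h1 => iSup_le fun h2 =>
            le_iSup_of_le (h1.trans h2) le_rfl
      nonneg := fun q hq => iSup_pos (hq.trans one_pos) }

/-- `q < x · y` iff `q < s · t` for some non-negative rationals `s ≺ x` and `t ≺ y`. -/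
instance : Mul (NNLower H) where
  mul x y :=
    { lt := fun q => ⨆ (s : ℚ) (t : ℚ) (_ : 0 ≤ s ∧ 0 ≤ t ∧ q < s * t), x.below s ⊓ y.below t
      rounded := by
        intro q
        apply le_antisymm
        · refine iSup_le fun s => iSup_le fun t => iSup_le fun h => ?_
          obtain ⟨q', h1, h2⟩ := exists_between h.2.2
          exact le_iSup_of_le q' (le_iSup_of_le h1 (le_iSup_of_le s (le_iSup_of_le t
            (le_iSup_of_le ⟨h.1, h.2.1, h2⟩ le_rfl))))
        · exact iSup_le fun q' => iSup_le fun h1 => iSup_le fun s => iSup_le fun t =>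
            iSup_le fun h => le_iSup_of_le s (le_iSup_of_le t
              (le_iSup_of_le ⟨h.1, h.2.1, h1.trans h.2.2⟩ le_rfl))
      nonneg := fun q hq => by
        refine top_le_iff.1 (le_iSup_of_le 0 (le_iSup_of_le 0 (le_iSup_of_le
          ⟨le_rfl, le_rfl, by simpa using hq⟩ ?_)))
        simp [below] }

/-- `q < x ^ a` iff `q < s ^ a` for some non-negative rational `s ≺ x`. -/
def natPow (x : NNLower H) (a : ℕ) : NNLower H where
  lt q := ⨆ (s : ℚ) (_ : 0 ≤ s ∧ q < s ^ a), x.below s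
  rounded q := by
    apply le_antisymm
    · refine iSup_le fun s => iSup_le fun h => ?_
      obtain ⟨q', h1, h2⟩ := exists_between h.2
      exact le_iSup_of_le q' (le_iSup_of_le h1 (le_iSup_of_le s (le_iSup_of_le ⟨h.1, h2⟩ le_rfl)))
    · exact iSup_le fun q' => iSup_le fun h1 => iSup_le fun s => iSup_le fun h =>
        le_iSup_of_le s (le_iSup_of_le ⟨h.1, h1.trans h.2⟩ le_rfl)
  nonneg q hq := by
    refine top_le_iff.1 (le_iSup_of_le 0 (le_iSup_of_le ⟨le_rfl, hq.trans_le (by positivity)⟩ ?_))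
    simp [below]

theorem lt_anti (x : NNLower H) {q q' : ℚ} (h : q ≤ q') : x.lt q' ≤ x.lt q := by
  rcases h.eq_or_lt with rfl | h
  · exact le_rfl
  · conv_rhs => rw [x.rounded q]
    exact le_iSup_of_le q' (le_iSup_of_le h le_rfl)

/-- `q < x ^ (1/b)` iff `q < 0`, or `0 ≤ q` and `q ^ b < x`. -/
def root (x : NNLower H) (b : ℕ+) : NNLower H where
  lt q := (⨆ (_ : q < 0), ⊤) ⊔ ⨆ (_ : 0 ≤ q), x.lt (q ^ (b : ℕ))
  rounded q := by
    apply le_antisymm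
    · refine sup_le (iSup_le fun h => ?_) (iSup_le fun h => ?_)
      · obtain ⟨q', h1, h2⟩ := exists_between h
        exact le_iSup_of_le q' (le_iSup_of_le h1 (le_sup_of_le_left (le_iSup_of_le h2 le_rfl)))
      · rw [x.rounded]
        refine iSup_le fun r => iSup_le fun hr => ?_
        obtain ⟨s, hs, h1, h2⟩ := exists_rat_pow_btwn b.ne_zero hr
          ((pow_nonneg h _).trans_lt hr)
        simp only [Rat.cast_id] at h1 h2
        exact le_iSup_of_le s (le_iSup_of_le (lt_of_pow_lt_pow_left₀ _ hs.le h1)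
          (le_sup_of_le_right (le_iSup_of_le hs.le (x.lt_anti h2.le))))
    · refine iSup_le fun q' => iSup_le fun hq => sup_le (iSup_le fun h => ?_) (iSup_le fun h => ?_)
      · exact le_sup_of_le_left (le_iSup_of_le (hq.trans h) le_rfl)
      · rcases lt_or_ge q 0 with h0 | h0
        · exact le_sup_of_le_left (le_iSup_of_le h0 le_top)
        · exact le_sup_of_le_right (le_iSup_of_le h0
            (x.lt_anti (pow_le_pow_left₀ h0 hq.le _)))
  nonneg q hq := top_le_iff.1 (le_sup_of_le_left (le_iSup_of_le hq le_rfl))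

/-- `x ^ q := (x ^ a) ^ (1/b)`, for `q = a / b` in lowest terms. -/
instance : Pow (NNLower H) ℚ≥0 where
  pow x q := (x.natPow q.num).root ⟨q.den, q.den_pos⟩

end NNLower

end LowerReals

section UpperReals

variable {H : Type u} [Order.Frame H] {K : Type v} [Order.Frame K]

namespace NNUpper

/-- Transport of an upper real along a frame homomorphism. -/
def map (f : FrameHom H K) (x : NNUpper H) : NNUpper K where
  gt r := f (x.gt r)
  rounded r := by
    conv_lhs => rw [x.rounded r]
    simp only [map_iSup]
  nonneg := by rw [x.nonneg, map_bot]

theorem gt_mono (x : NNUpper H) {r r' : ℚ} (h : r' ≤ r) : x.gt r' ≤ x.gt r := by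
  rcases h.eq_or_lt with rfl | h
  · exact le_rfl
  · conv_rhs => rw [x.rounded r]
    exact le_iSup_of_le r' (le_iSup_of_le h le_rfl)

theorem gt_nonpos (x : NNUpper H) {r : ℚ} (h : r ≤ 0) : x.gt r = ⊥ :=
  le_bot_iff.1 ((x.gt_mono h).trans x.nonneg.le)

instance : One (NNUpper H) where
  one :=
    { gt := fun r => ⨆ (_ : 1 < r), ⊤
      rounded := by
        intro r
        apply le_antisymm
        · refine iSup_le fun h => ?_
          obtain ⟨r', h1, h2⟩ := exists_between h
          exact le_iSup_of_le r' (le_iSup_of_le h2 (le_iSup_of_le h1 le_rfl))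
        · exact iSup_le fun r' => iSup_le fun h1 => iSup_le fun h2 =>
            le_iSup_of_le (h2.trans h1) le_rfl
      nonneg := by simp }

/-- `x · y < r` iff `s · t < r` for some rationals `s > x` and `t > y` (automatically positive). -/
instance : Mul (NNUpper H) where
  mul x y :=
    { gt := fun r => ⨆ (s : ℚ) (t : ℚ) (_ : s * t < r), x.gt s ⊓ y.gt t
      rounded := by
        intro r
        apply le_antisymm
        · refine iSup_le fun s => iSup_le fun t => iSup_le fun h => ?_
          obtain ⟨r', h1, h2⟩ := exists_between h
          exact le_iSup_of_le r' (le_iSup_of_le h2 (le_iSup_of_le s (le_iSup_of_le t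
            (le_iSup_of_le h1 le_rfl))))
        · exact iSup_le fun r' => iSup_le fun h1 => iSup_le fun s => iSup_le fun t =>
            iSup_le fun h => le_iSup_of_le s (le_iSup_of_le t (le_iSup_of_le (h.trans h1) le_rfl))
      nonneg := by
        refine le_bot_iff.1 (iSup_le fun s => iSup_le fun t => iSup_le fun h => ?_)
        rcases le_or_gt s 0 with hs | hs
        · simp [x.gt_nonpos hs]
        · have ht : t ≤ 0 := by
            by_contra! ht
            exact absurd (mul_pos hs ht) h.not_gt
          simp [y.gt_nonpos ht] }

/-- `x ^ a < r` iff `s ^ a < r` for some positive rational `s > x`, or for `s = ∞`.  Non-negative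
upper reals are the rounded ideals of the positive rationals together with `∞`, where `∞` belongs
to every ideal; `∞ ^ 0 = 1`, and `∞ ^ a = ∞` otherwise. -/
def natPow (x : NNUpper H) (a : ℕ) : NNUpper H where
  gt r := (⨆ (s : ℚ) (_ : 0 < s ∧ s ^ a < r), x.gt s) ⊔ ⨆ (_ : a = 0 ∧ 1 < r), ⊤
  rounded r := by
    apply le_antisymm
    · refine sup_le (iSup_le fun s => iSup_le fun h => ?_) (iSup_le fun h => ?_)
      · obtain ⟨r', h1, h2⟩ := exists_between h.2
        exact le_iSup_of_le r' (le_iSup_of_le h2 (le_sup_of_le_left (le_iSup_of_le s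
          (le_iSup_of_le ⟨h.1, h1⟩ le_rfl))))
      · obtain ⟨r', h1, h2⟩ := exists_between h.2
        exact le_iSup_of_le r' (le_iSup_of_le h2 (le_sup_of_le_right
          (le_iSup_of_le ⟨h.1, h1⟩ le_rfl)))
    · refine iSup_le fun r' => iSup_le fun h1 => sup_le
        (iSup_le fun s => iSup_le fun h => ?_) (iSup_le fun h => ?_)
      · exact le_sup_of_le_left (le_iSup_of_le s (le_iSup_of_le ⟨h.1, h.2.trans h1⟩ le_rfl))
      · exact le_sup_of_le_right (le_iSup_of_le ⟨h.1, h.2.trans h1⟩ le_rfl)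
  nonneg := by
    refine le_bot_iff.1 (sup_le (iSup_le fun s => iSup_le fun h => ?_) (iSup_le fun h => ?_))
    · exact absurd (pow_pos h.1 a) h.2.not_gt
    · exact absurd h.2 (by norm_num)

/-- `x ^ (1/b) < r` iff `0 < r` and `x < r ^ b`. -/
def root (x : NNUpper H) (b : ℕ+) : NNUpper H where
  gt r := ⨆ (_ : 0 < r), x.gt (r ^ (b : ℕ))
  rounded r := by
    apply le_antisymm
    · refine iSup_le fun h => ?_
      rw [x.rounded]
      refine iSup_le fun q => iSup_le fun hq => ?_
      obtain ⟨s, hs, h1, h2⟩ := exists_rat_pow_btwn b.ne_zero hq (pow_pos h _)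
      simp only [Rat.cast_id] at h1 h2
      exact le_iSup_of_le s (le_iSup_of_le (lt_of_pow_lt_pow_left₀ _ h.le h2)
        (le_iSup_of_le hs (x.gt_mono h1.le)))
    · exact iSup_le fun r' => iSup_le fun h1 => iSup_le fun h =>
        le_iSup_of_le (h.trans h1) (x.gt_mono (pow_le_pow_left₀ h.le h1.le _))
  nonneg := by simp

/-- `x ^ q := (x ^ a) ^ (1/b)`, for `q = a / b` in lowest terms. -/
instance : Pow (NNUpper H) ℚ≥0 where
  pow x q := (x.natPow q.num).root ⟨q.den, q.den_pos⟩

end NNUpper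

end UpperReals

section DedekindReals

variable {H : Type u} [Order.Frame H] {K : Type v} [Order.Frame K]

namespace NNDedekind

theorem left_inhabited_of_nonneg (x : NNLower H) : ⨆ q : ℚ, x.lt q = ⊤ :=
  top_le_iff.1 (le_iSup_of_le (-1) (x.nonneg _ (by norm_num)).ge)

/-- Transport of a Dedekind real along a frame homomorphism. -/
def map (f : FrameHom H K) (x : NNDedekind H) : NNDedekind K where
  lower := x.lower.map f
  upper := x.upper.map f
  left_inhabited := left_inhabited_of_nonneg _
  right_inhabited := by
    simpa [NNUpper.map] using congrArg f x.right_inhabited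
  separated q r := by
    simpa only [NNLower.map, NNUpper.map, map_inf, map_iSup, map_top] using
      OrderHomClass.mono f (x.separated q r)
  located q r h := by
    simpa [NNLower.map, NNUpper.map] using congrArg f (x.located q r h)

instance : One (NNDedekind H) where
  one :=
    { lower := 1
      upper := 1
      left_inhabited := left_inhabited_of_nonneg _
      right_inhabited := top_le_iff.1 (le_iSup_of_le 2 (le_iSup_of_le (by norm_num) le_rfl))
      separated := fun q r => by
        change (⨆ (_ : q < 1), ⊤) ⊓ (⨆ (_ : 1 < r), ⊤) ≤ _
        by_cases h1 : q < 1
        · by_cases h2 : 1 < r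
          · simp [h1.trans h2]
          · simp [h2]
        · simp [h1]
      located := fun q r h => by
        change (⨆ (_ : q < 1), ⊤) ⊔ (⨆ (_ : 1 < r), ⊤) = _
        by_cases h1 : q < 1
        · simp [h1]
        · simp [(not_lt.1 h1).trans_lt h] }

theorem lt_inf_gt_eq_bot (x : NNDedekind H) {q r : ℚ} (h : r ≤ q) :
    x.lower.lt q ⊓ x.upper.gt r = ⊥ := by
  have := x.separated q r
  rwa [iSup_neg h.not_gt, le_bot_iff] at this

theorem below_inf_gt_eq_bot (x : NNDedekind H) {q r : ℚ} (h : r ≤ q) :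
    x.lower.below q ⊓ x.upper.gt r = ⊥ := by
  rw [NNLower.below, inf_sup_right, x.lt_inf_gt_eq_bot h, bot_sup_eq]
  by_cases hq : q = 0
  · rw [x.upper.gt_nonpos (h.trans hq.le), inf_bot_eq]
  · simp [hq]

/-- A Dedekind real is enclosed between rationals that are arbitrarily close to each other. -/
theorem approx (x : NNDedekind H) {e : ℚ} (he : 0 < e) :
    ⨆ (s : ℚ) (s' : ℚ) (_ : s' - s ≤ e), x.lower.lt s ⊓ x.upper.gt s' = ⊤ := by
  set A := ⨆ (s : ℚ) (s' : ℚ) (_ : s' - s ≤ e), x.lower.lt s ⊓ x.upper.gt s' with hA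
  have key : ∀ n : ℕ, x.upper.gt (n * (e / 2)) ≤ A := by
    intro n
    induction n with
    | zero => simp [x.upper.nonneg]
    | succ n ih =>
      have hl := x.located ((n - 1) * (e / 2)) (n * (e / 2)) (by linarith)
      calc x.upper.gt ((n + 1 : ℕ) * (e / 2))
          = (x.lower.lt ((n - 1) * (e / 2)) ⊔ x.upper.gt (n * (e / 2))) ⊓
              x.upper.gt ((n + 1 : ℕ) * (e / 2)) := by rw [hl, top_inf_eq]
        _ ≤ A := by
          rw [inf_sup_right]
          refine sup_le ?_ (inf_le_left.trans ih)
          refine le_iSup_of_le _ (le_iSup_of_le _ (le_iSup_of_le ?_ le_rfl))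
          push_cast
          linarith
  rw [← top_le_iff, ← x.right_inhabited]
  refine iSup_le fun r => ?_
  obtain ⟨n, hn⟩ := exists_nat_ge (r / (e / 2))
  exact (x.upper.gt_mono ((div_le_iff₀ (by positivity)).1 hn)).trans (key n)

theorem mul_located (x y : NNDedekind H) (q r : ℚ) (h : q < r) :
    (x.lower * y.lower).lt q ⊔ (x.upper * y.upper).gt r = ⊤ := by
  rcases lt_or_ge q 0 with hq | hq
  · rw [NNLower.nonneg _ q hq, top_sup_eq]
  set B := (x.lower * y.lower).lt q ⊔ (x.upper * y.upper).gt r with hB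
  rw [← top_le_iff]
  have h1 : ∀ M : ℚ, ∀ N : ℚ, x.upper.gt M ⊓ y.upper.gt N ≤ B := by
    intro M N
    rcases le_or_gt M 0 with hM | hM
    · simp [x.upper.gt_nonpos hM]
    rcases le_or_gt N 0 with hN | hN
    · simp [y.upper.gt_nonpos hN]
    obtain ⟨e, he, hlt⟩ : ∃ e : ℚ, 0 < e ∧ e * (M + N) < r - q :=
      ⟨(r - q) / (2 * (M + N)), div_pos (by linarith) (by positivity), by
        rw [div_mul_eq_mul_div, div_lt_iff₀ (by positivity)]
        nlinarith [mul_pos (sub_pos.2 h) (add_pos hM hN)]⟩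
    calc x.upper.gt M ⊓ y.upper.gt N
        = x.upper.gt M ⊓ y.upper.gt N ⊓
            ((⨆ (s : ℚ) (s' : ℚ) (_ : s' - s ≤ e), x.lower.lt s ⊓ x.upper.gt s') ⊓
             (⨆ (t : ℚ) (t' : ℚ) (_ : t' - t ≤ e), y.lower.lt t ⊓ y.upper.gt t')) := by
          rw [x.approx he, y.approx he, top_inf_eq, inf_top_eq]
      _ ≤ B := by
          simp only [inf_iSup_eq, iSup_inf_eq]
          refine iSup_le fun t => iSup_le fun t' => iSup_le fun ht => iSup_le fun s =>
            iSup_le fun s' => iSup_le fun hs => ?_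
          by_cases hc : 0 ≤ s ∧ 0 ≤ t ∧ q < s * t
          · refine le_sup_of_le_left (le_iSup_of_le s (le_iSup_of_le t (le_iSup_of_le hc ?_)))
            refine inf_le_right.trans (inf_le_inf ?_ ?_) <;>
              exact inf_le_left.trans le_sup_left
          set a := min s' M with ha
          set b := min t' N with hb
          have hxa : x.upper.gt a = x.upper.gt s' ⊓ x.upper.gt M :=
            Monotone.map_inf (fun _ _ h => x.upper.gt_mono h) s' M
          have hyb : y.upper.gt b = y.upper.gt t' ⊓ y.upper.gt N :=
            Monotone.map_inf (fun _ _ h => y.upper.gt_mono h) t' N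
          have hle : x.upper.gt M ⊓ y.upper.gt N ⊓
              (x.lower.lt s ⊓ x.upper.gt s' ⊓ (y.lower.lt t ⊓ y.upper.gt t')) ≤
              (x.lower.lt s ⊓ x.upper.gt a) ⊓ (y.lower.lt t ⊓ y.upper.gt b) := by
            rw [hxa, hyb]
            refine le_of_eq ?_
            ac_rfl
          refine hle.trans ?_
          rcases le_or_gt a s with h1 | h1
          · simp [x.lt_inf_gt_eq_bot h1]
          rcases le_or_gt b t with h2 | h2
          · simp [y.lt_inf_gt_eq_bot h2]
          rcases le_or_gt a 0 with h3 | h3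
          · simp [x.upper.gt_nonpos h3]
          rcases le_or_gt b 0 with h4 | h4
          · simp [y.upper.gt_nonpos h4]
          refine le_sup_of_le_right (le_iSup_of_le a (le_iSup_of_le b (le_iSup_of_le ?_
            (inf_le_inf inf_le_right inf_le_right))))
          have e1 : a ≤ s + e := (min_le_left _ _).trans (by linarith)
          have e2 : b ≤ t + e := (min_le_left _ _).trans (by linarith)
          have e3 : a ≤ M := min_le_right _ _
          have e4 : b ≤ N := min_le_right _ _
          rcases lt_or_ge s 0 with hs0 | hs0
          · nlinarith
          rcases lt_or_ge t 0 with ht0 | ht0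
          · nlinarith
          have : s * t ≤ q := by
            by_contra! hcc
            exact hc ⟨hs0, ht0, hcc⟩
          nlinarith
  calc (⊤ : H) = (⨆ M : ℚ, x.upper.gt M) ⊓ (⨆ N : ℚ, y.upper.gt N) := by
        rw [x.right_inhabited, y.right_inhabited, top_inf_eq]
    _ ≤ B := by
        simp only [inf_iSup_eq, iSup_inf_eq]
        exact iSup_le fun N => iSup_le fun M => h1 M N

/-- Multiplication acts separately on the left and right sections. -/
instance : Mul (NNDedekind H) where
  mul x y :=
    { lower := x.lower * y.lower
      upper := x.upper * y.upper
      left_inhabited := left_inhabited_of_nonneg _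
      right_inhabited := by
        rw [← top_le_iff]
        calc (⊤ : H) = (⨆ M : ℚ, x.upper.gt M) ⊓ (⨆ N : ℚ, y.upper.gt N) := by
              rw [x.right_inhabited, y.right_inhabited, top_inf_eq]
          _ ≤ _ := by
              simp only [inf_iSup_eq, iSup_inf_eq]
              exact iSup_le fun N => iSup_le fun M => le_iSup_of_le (M * N + 1)
                (le_iSup_of_le M (le_iSup_of_le N (le_iSup_of_le (by linarith) le_rfl)))
      separated := fun q r => by
        by_cases hqr : q < r
        · simp [hqr]
        rw [iSup_neg hqr, le_bot_iff]
        change (⨆ (s : ℚ) (t : ℚ) (_ : 0 ≤ s ∧ 0 ≤ t ∧ q < s * t),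
          x.lower.below s ⊓ y.lower.below t) ⊓
          (⨆ (s : ℚ) (t : ℚ) (_ : s * t < r), x.upper.gt s ⊓ y.upper.gt t) = ⊥
        simp only [inf_iSup_eq, iSup_inf_eq]
        refine le_bot_iff.1 (iSup_le fun s' => iSup_le fun t' => iSup_le fun h' =>
          iSup_le fun s => iSup_le fun t => iSup_le fun h => ?_)
        have hrw : x.lower.below s ⊓ y.lower.below t ⊓ (x.upper.gt s' ⊓ y.upper.gt t') =
            (x.lower.below s ⊓ x.upper.gt s') ⊓ (y.lower.below t ⊓ y.upper.gt t') := by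
          ac_rfl
        rw [hrw]
        rcases le_or_gt s' s with h1 | h1
        · simp [x.below_inf_gt_eq_bot h1]
        rcases le_or_gt t' t with h2 | h2
        · simp [y.below_inf_gt_eq_bot h2]
        have := mul_le_mul h1.le h2.le h.2.1 (h.1.trans h1.le)
        exact absurd (h.2.2.trans_le (this.trans h'.le)) hqr
      located := mul_located x y }

/-- `x ^ a := (L_x ^ a, R_x ^ a)`. -/
def natPow (x : NNDedekind H) (a : ℕ) : NNDedekind H where
  lower := x.lower.natPow a
  upper := x.upper.natPow a
  left_inhabited := left_inhabited_of_nonneg _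
  right_inhabited := by
    rw [← top_le_iff, ← x.right_inhabited]
    refine iSup_le fun r => ?_
    rcases le_or_gt r 0 with h | h
    · simp [x.upper.gt_nonpos h]
    · exact le_iSup_of_le (r ^ a + 1) (le_sup_of_le_left
        (le_iSup_of_le r (le_iSup_of_le ⟨h, by linarith⟩ le_rfl)))
  separated q r := by
    by_cases hqr : q < r
    · simp [hqr]
    rw [iSup_neg hqr, le_bot_iff]
    change (⨆ (s : ℚ) (_ : 0 ≤ s ∧ q < s ^ a), x.lower.below s) ⊓
      ((⨆ (s : ℚ) (_ : 0 < s ∧ s ^ a < r), x.upper.gt s) ⊔ ⨆ (_ : a = 0 ∧ 1 < r), ⊤) = ⊥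
    rw [inf_sup_left]
    simp only [inf_iSup_eq, iSup_inf_eq]
    refine le_bot_iff.1 (sup_le (iSup_le fun s' => iSup_le fun h' => iSup_le fun s =>
      iSup_le fun h => ?_) (iSup_le fun h' => iSup_le fun s => iSup_le fun h => ?_))
    · rcases le_or_gt s' s with h1 | h1
      · exact (x.below_inf_gt_eq_bot h1).le
      · have := pow_le_pow_left₀ h.1 h1.le a
        exact absurd (h.2.trans_le (this.trans h'.2.le)) hqr
    · have h2 := h.2
      rw [h'.1, pow_zero] at h2
      exact absurd (h2.trans h'.2) hqr
  located q r h := by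
    rcases lt_or_ge q 0 with hq | hq
    · rw [NNLower.nonneg _ q hq, top_sup_eq]
    rw [← top_le_iff]
    rcases Nat.eq_zero_or_pos a with rfl | ha
    · rcases lt_or_ge q 1 with h1 | h1
      · refine le_sup_of_le_left (le_iSup_of_le 0 (le_iSup_of_le ⟨le_rfl, by simpa using h1⟩ ?_))
        simp [NNLower.below]
      · exact le_sup_of_le_right (le_sup_of_le_right
          (le_iSup_of_le ⟨rfl, h1.trans_lt h⟩ le_rfl))
    · obtain ⟨s, hs, h1, h2⟩ := exists_rat_pow_btwn ha.ne' h (hq.trans_lt h)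
      obtain ⟨t, ht, h3, h4⟩ := exists_rat_pow_btwn ha.ne' h2 (hq.trans_lt h)
      simp only [Rat.cast_id] at h1 h2 h3 h4
      rw [← x.located s t (lt_of_pow_lt_pow_left₀ _ ht.le h3)]
      refine sup_le_sup ?_ ?_
      · exact le_iSup_of_le s (le_iSup_of_le ⟨hs.le, h1⟩ le_sup_left)
      · exact le_sup_of_le_left (le_iSup_of_le t (le_iSup_of_le ⟨ht, h4⟩ le_rfl))

/-- The root acts separately on the left and right sections. -/
def root (x : NNDedekind H) (b : ℕ+) : NNDedekind H where
  lower := x.lower.root b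
  upper := x.upper.root b
  left_inhabited := left_inhabited_of_nonneg _
  right_inhabited := by
    rw [← top_le_iff, ← x.right_inhabited]
    refine iSup_le fun r => ?_
    rcases le_or_gt r 0 with h | h
    · simp [x.upper.gt_nonpos h]
    · refine le_iSup_of_le (r + 1) (le_iSup_of_le (by linarith) (x.upper.gt_mono ?_))
      exact (by linarith : r ≤ r + 1).trans (le_self_pow₀ (by linarith) b.ne_zero)
  separated q r := by
    by_cases hqr : q < r
    · simp [hqr]
    rw [iSup_neg hqr, le_bot_iff]
    change ((⨆ (_ : q < 0), ⊤) ⊔ ⨆ (_ : 0 ≤ q), x.lower.lt (q ^ (b : ℕ))) ⊓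
      (⨆ (_ : 0 < r), x.upper.gt (r ^ (b : ℕ))) = ⊥
    rcases le_or_gt r 0 with hr | hr
    · simp [hr.not_gt]
    have hq : 0 ≤ q := hr.le.trans (not_lt.1 hqr)
    simp only [hr, hq, hq.not_gt, iSup_pos, iSup_neg, not_false_eq_true, bot_sup_eq]
    exact x.lt_inf_gt_eq_bot (pow_le_pow_left₀ hr.le (not_lt.1 hqr) _)
  located q r h := by
    rcases lt_or_ge q 0 with hq | hq
    · rw [NNLower.nonneg _ q hq, top_sup_eq]
    rw [← top_le_iff, ← x.located _ _ (pow_lt_pow_left₀ h hq b.ne_zero)]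
    exact sup_le_sup (le_sup_of_le_right (le_iSup_of_le hq le_rfl))
      (le_iSup_of_le (hq.trans_lt h) le_rfl)

/-- `x ^ q := (x ^ a) ^ (1/b)`, for `q = a / b` in lowest terms. -/
instance : Pow (NNDedekind H) ℚ≥0 where
  pow x q := (x.natPow q.num).root ⟨q.den, q.den_pos⟩

end NNDedekind

end DedekindReals

/-- The Basic Equations for an exponentiation with non-negative rational exponents: the two
exponent laws (addition and multiplication of exponents) and the base product law. -/
structure BasicEquations (M : Type u) [One M] [Mul M] [Pow M ℚ≥0] : Prop where
  pow_add : ∀ (x : M) (q q' : ℚ≥0), x ^ (q + q') = x ^ q * x ^ q'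
  pow_zero : ∀ x : M, x ^ (0 : ℚ≥0) = 1
  pow_mul : ∀ (x : M) (q q' : ℚ≥0), x ^ (q * q') = (x ^ q) ^ q'
  pow_one : ∀ x : M, x ^ (1 : ℚ≥0) = x
  mul_pow : ∀ (x y : M) (q : ℚ≥0), (x * y) ^ q = x ^ q * y ^ q
  one_pow : ∀ q : ℚ≥0, (1 : M) ^ q = 1

end PointFree

/-! A lower real is the join of the rationals below it, so each construction is governed by what it
does to rational points. For `0 ≤ r` the truth value of `r < (x^a)^{1/b}` is the join of `s ≺ x`
over rationals `s ≥ 0` with `r^b < s^a`. This condition says `r < s^{a/b}` for the real power of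
`s`, so it depends on `a` and `b` only through the number `a/b`: that is well-definedness
(`lt_root_natPow`, and dually `gt_root_natPow`). Real powers occur only in conditions on rational
indices, never in truth values, so a frame homomorphism passes through the joins.

Each Basic Equation then compares two joins by matching indices. The algebra is that of real powers.
Since `s^q` need not be rational, a product or iterated power also needs rational intermediate
points, supplied by the four `exists_rat_...` lemmas from density of the rationals. Only the
addition law uses one base twice: its two witnesses are merged into their maximum for lower reals
and their minimum for upper reals.

Exponent 0 is treated apart. There the value 1 comes from the boundary points `0 ≺ x` (lower) and `∞
> x` (upper), which contribute nothing for positive exponents. Dedekind reals inherit everything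
from their two sections. -/

namespace PointFree

universe u v

/-! ### Rational interpolation for real powers and products -/

section RationalApproximation

variable {y z r t : ℝ}

/-- Taking `t`-th roots, `r^{1/t} < y`, and any rational strictly between the two serves as `w`. -/
theorem exists_rat_lt_rpow (hr : 0 ≤ r) (hy : 0 ≤ y) (ht : 0 < t) (h : r < y ^ t) :
    ∃ w : ℚ, 0 < w ∧ (w : ℝ) < y ∧ r < (w : ℝ) ^ t := by
  obtain ⟨w, h1, h2⟩ := exists_rat_btwn ((Real.rpow_inv_lt_iff_of_pos hr hy ht).2 h)
  have hw : (0 : ℝ) < w := (Real.rpow_nonneg hr _).trans_lt h1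
  exact ⟨w, by exact_mod_cast hw, h2, (Real.rpow_inv_lt_iff_of_pos hr hw.le ht).1 h1⟩

theorem exists_rat_rpow_lt (hy : 0 ≤ y) (ht : 0 < t) (h : y ^ t < r) :
    ∃ w : ℚ, 0 < w ∧ y < (w : ℝ) ∧ (w : ℝ) ^ t < r := by
  have hr : 0 ≤ r := (Real.rpow_nonneg hy _).trans h.le
  obtain ⟨w, h1, h2⟩ := exists_rat_btwn ((Real.lt_rpow_inv_iff_of_pos hy hr ht).2 h)
  have hw : (0 : ℝ) < w := hy.trans_lt h1
  exact ⟨w, by exact_mod_cast hw, h1, (Real.lt_rpow_inv_iff_of_pos hw.le hr ht).1 h2⟩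

/-- The factors are found one after the other: `w` between `r / z` and `y`, then `w'` between `r /
w` and `z`. Because `r ≥ 0`, the inequality already excludes `z = 0`, and both witnesses are
positive. -/
theorem exists_rat_lt_mul (hr : 0 ≤ r) (hz : 0 ≤ z) (h : r < y * z) :
    ∃ w w' : ℚ, 0 < w ∧ 0 < w' ∧ (w : ℝ) < y ∧ (w' : ℝ) < z ∧ r < w * w' := by
  have hz' : 0 < z := hz.lt_of_ne fun h0 => by
    rw [← h0, mul_zero] at h
    exact h.not_ge hr
  obtain ⟨w, h1, h2⟩ := exists_rat_btwn ((div_lt_iff₀ hz').2 h)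
  have hw : (0 : ℝ) < w := (div_nonneg hr hz).trans_lt h1
  obtain ⟨w', h3, h4⟩ := exists_rat_btwn ((div_lt_iff₀' hw).2 ((div_lt_iff₀ hz').1 h1))
  have hw' : (0 : ℝ) < w' := (div_nonneg hr hw.le).trans_lt h3
  exact ⟨w, w', by exact_mod_cast hw, by exact_mod_cast hw', h2, h4, (div_lt_iff₀' hw).1 h3⟩

theorem exists_rat_mul_lt (hy : 0 < y) (hz : 0 < z) (h : y * z < r) :
    ∃ w w' : ℚ, y < (w : ℝ) ∧ z < (w' : ℝ) ∧ (w : ℝ) * w' < r := by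
  obtain ⟨w, h1, h2⟩ := exists_rat_btwn ((lt_div_iff₀ hz).2 h)
  have hw : (0 : ℝ) < w := hy.trans h1
  obtain ⟨w', h3, h4⟩ := exists_rat_btwn ((lt_div_iff₀' hw).2 ((lt_div_iff₀ hz).1 h2))
  exact ⟨w, w', h1, h3, (lt_div_iff₀' hw).1 h4⟩

theorem rpow_natCast_div_pow {s : ℝ} (hs : 0 ≤ s) (a : ℕ) (b : ℕ+) :
    (s ^ ((a : ℝ) / (b : ℕ))) ^ (b : ℕ) = s ^ a := by
  rw [← Real.rpow_natCast, ← Real.rpow_mul hs,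
    div_mul_cancel₀ _ (Nat.cast_ne_zero.2 b.ne_zero), Real.rpow_natCast]

/-- Raising to the `b`-th power is strictly monotone on non-negative reals and clears the
denominator of the exponent, leaving a comparison inside `ℚ`. -/
theorem lt_rpow_natCast_div_iff {q s : ℚ} (hq : 0 ≤ q) (hs : 0 ≤ s) (a : ℕ) (b : ℕ+) :
    (q : ℝ) < (s : ℝ) ^ ((a : ℝ) / (b : ℕ)) ↔ q ^ (b : ℕ) < s ^ a := by
  have hs' : (0 : ℝ) ≤ s := by exact_mod_cast hs
  rw [← pow_lt_pow_iff_left₀ (by exact_mod_cast hq) (Real.rpow_nonneg hs' _) b.ne_zero,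
    rpow_natCast_div_pow hs']
  exact_mod_cast Iff.rfl

theorem rpow_natCast_div_lt_iff {q s : ℚ} (hq : 0 ≤ q) (hs : 0 ≤ s) (a : ℕ) (b : ℕ+) :
    (s : ℝ) ^ ((a : ℝ) / (b : ℕ)) < (q : ℝ) ↔ s ^ a < q ^ (b : ℕ) := by
  have hs' : (0 : ℝ) ≤ s := by exact_mod_cast hs
  rw [← pow_lt_pow_iff_left₀ (Real.rpow_nonneg hs' _) (by exact_mod_cast hq) b.ne_zero,
    rpow_natCast_div_pow hs']
  exact_mod_cast Iff.rfl

theorem natCast_div_real_eq {a c : ℕ} {b d : ℕ+}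
    (h : (a : ℚ≥0) / ((b : ℕ) : ℚ≥0) = (c : ℚ≥0) / ((d : ℕ) : ℚ≥0)) :
    (a : ℝ) / (b : ℕ) = (c : ℝ) / (d : ℕ) := by
  simpa using congrArg (NNRat.cast : ℚ≥0 → ℝ) h

end RationalApproximation

/-! ### Lower reals -/

namespace NNLower

variable {H : Type u} [Order.Frame H] {K : Type v} [Order.Frame K]

theorem ext_nonneg {x y : NNLower H} (h : ∀ r, 0 ≤ r → x.lt r = y.lt r) : x = y := by
  ext r
  rcases lt_or_ge r 0 with hr | hr
  · rw [x.nonneg r hr, y.nonneg r hr]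
  · exact h r hr

theorem lt_mul (x y : NNLower H) (q : ℚ) : (x * y).lt q =
    ⨆ (s : ℚ) (t : ℚ) (_ : 0 ≤ s ∧ 0 ≤ t ∧ q < s * t), x.below s ⊓ y.below t := rfl

theorem lt_one (q : ℚ) : (1 : NNLower H).lt q = ⨆ (_ : q < 1), ⊤ := rfl

theorem below_of_pos (x : NNLower H) {s : ℚ} (hs : 0 < s) : x.below s = x.lt s := by
  simp [below, hs.ne']

theorem below_zero (x : NNLower H) : x.below 0 = ⊤ := by simp [below]

/-- If `0 ≤ q < s * t` with `s, t ≥ 0`, neither factor can vanish, so `≺` coincides with `<` on all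
indices that matter. -/
theorem lt_mul_of_nonneg (x y : NNLower H) {q : ℚ} (hq : 0 ≤ q) : (x * y).lt q =
    ⨆ (s : ℚ) (t : ℚ) (_ : 0 < s ∧ 0 < t ∧ q < s * t), x.lt s ⊓ y.lt t := by
  rw [lt_mul]
  apply le_antisymm
  · refine iSup_le fun s => iSup_le fun t => iSup_le fun ⟨hs, ht, h⟩ => ?_
    have hs' : 0 < s := hs.lt_of_ne fun h0 => by
      rw [← h0, zero_mul] at h; exact h.not_ge hq
    have ht' : 0 < t := ht.lt_of_ne fun h0 => by
      rw [← h0, mul_zero] at h; exact h.not_ge hq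
    rw [x.below_of_pos hs', y.below_of_pos ht']
    exact le_iSup_of_le s (le_iSup_of_le t (le_iSup_of_le ⟨hs', ht', h⟩ le_rfl))
  · refine iSup_le fun s => iSup_le fun t => iSup_le fun ⟨hs, ht, h⟩ => ?_
    rw [← x.below_of_pos hs, ← y.below_of_pos ht]
    exact le_iSup_of_le s (le_iSup_of_le t (le_iSup_of_le ⟨hs.le, ht.le, h⟩ le_rfl))

/-- The power is determined by the real number `a / b`. -/
theorem lt_root_natPow (x : NNLower H) (a : ℕ) (b : ℕ+) {r : ℚ} (hr : 0 ≤ r) :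
    ((x.natPow a).root b).lt r =
      ⨆ (s : ℚ) (_ : 0 ≤ s ∧ (r : ℝ) < (s : ℝ) ^ ((a : ℝ) / (b : ℕ))), x.below s := by
  change (⨆ (_ : r < 0), ⊤) ⊔ (⨆ (_ : 0 ≤ r), (x.natPow a).lt (r ^ (b : ℕ))) = _
  rw [iSup_neg hr.not_gt, bot_sup_eq, iSup_pos hr]
  change (⨆ (s : ℚ) (_ : 0 ≤ s ∧ r ^ (b : ℕ) < s ^ a), x.below s) = _
  exact iSup_congr fun s => iSup_congr_Prop
    (and_congr_right fun hs => (lt_rpow_natCast_div_iff hr hs a b).symm) fun _ => rfl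

theorem root_natPow_congr (x : NNLower H) {a c : ℕ} {b d : ℕ+}
    (h : (a : ℚ≥0) / ((b : ℕ) : ℚ≥0) = (c : ℚ≥0) / ((d : ℕ) : ℚ≥0)) :
    (x.natPow a).root b = (x.natPow c).root d :=
  ext_nonneg fun r hr => by
    rw [lt_root_natPow x a b hr, lt_root_natPow x c d hr, natCast_div_real_eq h]

theorem pow_div (x : NNLower H) (a : ℕ) (b : ℕ+) :
    x ^ ((a : ℚ≥0) / ((b : ℕ) : ℚ≥0)) = (x.natPow a).root b :=
  root_natPow_congr x (NNRat.num_div_den _)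

theorem lt_pow (x : NNLower H) (q : ℚ≥0) {r : ℚ} (hr : 0 ≤ r) :
    (x ^ q).lt r = ⨆ (s : ℚ) (_ : 0 ≤ s ∧ (r : ℝ) < (s : ℝ) ^ (q : ℝ)), x.below s := by
  have h : (q : ℝ) = (q.num : ℝ) / ((⟨q.den, q.den_pos⟩ : ℕ+) : ℕ) := NNRat.cast_def q
  rw [h]
  exact lt_root_natPow x _ _ hr

/-- For a positive exponent the index `s = 0` is void, since `0^q = 0 ≤ r`; on the remaining indices
`≺` is `<`. -/
theorem lt_pow_of_pos (x : NNLower H) {q : ℚ≥0} (hq : 0 < q) {r : ℚ} (hr : 0 ≤ r) :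
    (x ^ q).lt r = ⨆ (s : ℚ) (_ : 0 < s ∧ (r : ℝ) < (s : ℝ) ^ (q : ℝ)), x.lt s := by
  rw [lt_pow x q hr]
  have hq' : (q : ℝ) ≠ 0 := by exact_mod_cast hq.ne'
  refine iSup_congr fun s => ?_
  rcases lt_trichotomy s 0 with hs | rfl | hs
  · simp [hs.not_gt, hs.not_ge]
  · have : ¬ (r : ℝ) < 0 := not_lt.2 (by exact_mod_cast hr)
    simp [Real.zero_rpow hq', this]
  · simp [hs, hs.le, x.below_of_pos hs]

theorem pow_zero (x : NNLower H) : x ^ (0 : ℚ≥0) = 1 :=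
  ext_nonneg fun r hr => by
    rw [lt_pow x 0 hr, lt_one]
    by_cases h : r < 1
    · rw [iSup_pos h]
      -- The witness is `s = 0`, using `0^0 = 1` and `0 ≺ x`; no positive rational need lie below
      -- `x`.
      refine top_le_iff.1 (le_iSup_of_le 0 (le_iSup_of_le ⟨le_rfl, ?_⟩ x.below_zero.ge))
      simpa using by exact_mod_cast h
    · have h' : ¬ (r : ℝ) < 1 := by exact_mod_cast h
      simp [h, h']

theorem pow_one (x : NNLower H) : x ^ (1 : ℚ≥0) = x :=
  ext_nonneg fun r hr => by
    rw [lt_pow_of_pos x one_pos hr]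
    -- With exponent 1 the formula for the power is roundedness itself; positivity of `s` follows
    -- from `0 ≤ r < s`.
    conv_rhs => rw [x.rounded r]
    refine iSup_congr fun s => iSup_congr_Prop ?_ fun _ => rfl
    simp only [NNRat.cast_one, Real.rpow_one, Rat.cast_lt]
    exact ⟨fun h => h.2, fun h => ⟨hr.trans_lt h, h⟩⟩

theorem one_mul (x : NNLower H) : 1 * x = x :=
  ext_nonneg fun r hr => by
    rw [lt_mul_of_nonneg _ _ hr]
    apply le_antisymm
    · refine iSup_le fun s => iSup_le fun t => iSup_le fun ⟨hs, ht, h⟩ => ?_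
      rw [lt_one]
      by_cases h1 : s < 1
      · exact inf_le_right.trans (x.lt_anti (h.le.trans (mul_le_of_le_one_left ht.le h1.le)))
      · simp [h1]
    · conv_lhs => rw [x.rounded r]
      refine iSup_le fun t => iSup_le fun h => ?_
      have ht := hr.trans_lt h
      -- Roundedness has given `t > r` below `x`, which leaves room for a factor `s` with `r / t < s
      -- < 1`.
      obtain ⟨s, h1, h2⟩ := exists_between ((div_lt_one ht).2 h)
      refine le_iSup_of_le s (le_iSup_of_le t (le_iSup_of_le
        ⟨(div_nonneg hr ht.le).trans_lt h1, ht, (div_lt_iff₀ ht).1 h1⟩ ?_))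
      rw [lt_one, iSup_pos h2, top_inf_eq]

theorem mul_comm (x y : NNLower H) : x * y = y * x := by
  ext q
  rw [lt_mul, lt_mul, iSup_comm]
  refine iSup_congr fun s => iSup_congr fun t => iSup_congr_Prop ?_ fun _ => inf_comm _ _
  rw [_root_.mul_comm t s]
  tauto

theorem one_pow (q : ℚ≥0) : (1 : NNLower H) ^ q = 1 := by
  rcases eq_zero_or_pos q with rfl | hq
  · exact pow_zero 1
  have hq' : (0 : ℝ) < q := by exact_mod_cast hq
  refine ext_nonneg fun r hr => ?_
  rw [lt_pow_of_pos _ hq hr]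
  apply le_antisymm
  · refine iSup_le fun s => iSup_le fun ⟨hs, h⟩ => iSup_le fun h1 => ?_
    have : (r : ℝ) < 1 := h.trans_le
      (Real.rpow_le_one (by exact_mod_cast hs.le) (by exact_mod_cast h1.le) hq'.le)
    exact le_iSup_of_le (by exact_mod_cast this) le_rfl
  · refine iSup_le fun h => ?_
    obtain ⟨w, hw, h1, h2⟩ := exists_rat_lt_rpow (r := r) (y := 1) (by exact_mod_cast hr)
      zero_le_one hq' (by rw [Real.one_rpow]; exact_mod_cast h)
    exact le_iSup_of_le w (le_iSup_of_le ⟨hw, h2⟩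
      (le_iSup_of_le (by exact_mod_cast h1) le_rfl))

/-- One witness `s` splits as `s^q * s^q'`, with rational factors interpolated. Conversely the two
factors bring independent witnesses for the same `x`, and the larger one serves for both. -/
theorem pow_add (x : NNLower H) (q q' : ℚ≥0) : x ^ (q + q') = x ^ q * x ^ q' := by
  rcases eq_zero_or_pos q with rfl | hq
  · rw [zero_add, pow_zero, one_mul]
  rcases eq_zero_or_pos q' with rfl | hq'
  · rw [add_zero, pow_zero, mul_comm, one_mul]
  have hp : (0 : ℝ) < q := by exact_mod_cast hq
  have hp' : (0 : ℝ) < q' := by exact_mod_cast hq'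
  refine ext_nonneg fun r hr => ?_
  rw [lt_pow_of_pos _ (add_pos hq hq') hr, lt_mul_of_nonneg _ _ hr, NNRat.cast_add]
  apply le_antisymm
  · refine iSup_le fun s => iSup_le fun ⟨hs, h⟩ => ?_
    have hs' : (0 : ℝ) < s := by exact_mod_cast hs
    rw [Real.rpow_add hs'] at h
    obtain ⟨w, w', hw, hw', h1, h2, h3⟩ := exists_rat_lt_mul (by exact_mod_cast hr)
      (Real.rpow_nonneg hs'.le _) h
    refine le_iSup_of_le w (le_iSup_of_le w' (le_iSup_of_le
      ⟨hw, hw', by exact_mod_cast h3⟩ (le_inf ?_ ?_)))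
    · rw [lt_pow_of_pos _ hq hw.le]
      exact le_iSup_of_le s (le_iSup_of_le ⟨hs, h1⟩ le_rfl)
    · rw [lt_pow_of_pos _ hq' hw'.le]
      exact le_iSup_of_le s (le_iSup_of_le ⟨hs, h2⟩ le_rfl)
  · refine iSup_le fun w => iSup_le fun w' => iSup_le fun ⟨hw, hw', h⟩ => ?_
    rw [lt_pow_of_pos _ hq hw.le, lt_pow_of_pos _ hq' hw'.le]
    -- Frame distributivity pulls both joins out of the meet, the second factor's witness `t` coming
    -- first.
    simp only [inf_iSup_eq, iSup_inf_eq]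
    refine iSup_le fun t => iSup_le fun ⟨ht, h2⟩ => iSup_le fun s => iSup_le fun ⟨hs, h1⟩ => ?_
    have hw0 : (0 : ℝ) ≤ w' := by exact_mod_cast hw'.le
    have hs0 : (0 : ℝ) ≤ s := by exact_mod_cast hs.le
    have ht0 : (0 : ℝ) ≤ t := by exact_mod_cast ht.le
    have hm : (0 : ℝ) < (max s t : ℚ) := by exact_mod_cast lt_max_of_lt_left hs
    have hsm : (s : ℝ) ≤ (max s t : ℚ) := by exact_mod_cast le_max_left s t
    have htm : (t : ℝ) ≤ (max s t : ℚ) := by exact_mod_cast le_max_right s t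
    refine le_iSup_of_le (max s t) (le_iSup_of_le ⟨lt_max_of_lt_left hs, ?_⟩ ?_)
    · rw [Real.rpow_add hm]
      calc (r : ℝ) < w * w' := by exact_mod_cast h
        _ ≤ _ := mul_le_mul (h1.le.trans (Real.rpow_le_rpow hs0 hsm hp.le))
          (h2.le.trans (Real.rpow_le_rpow ht0 htm hp'.le)) hw0 (Real.rpow_nonneg hm.le _)
    -- The maximum is `s` or `t`, so its truth value is one of the two terms of the meet.
    · rcases max_choice s t with e | e <;> rw [e]
      · exact inf_le_left
      · exact inf_le_right

/-- Since `s^(q q') = (s^q)^q'`, the task is to pass between `r < (s^q)^q'` and a rational `w` with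
`w < s^q` and `r < w^q'`. -/
theorem pow_mul (x : NNLower H) (q q' : ℚ≥0) : x ^ (q * q') = (x ^ q) ^ q' := by
  rcases eq_zero_or_pos q with rfl | hq
  · rw [zero_mul, pow_zero, one_pow]
  rcases eq_zero_or_pos q' with rfl | hq'
  · rw [mul_zero, pow_zero, pow_zero]
  have hp' : (0 : ℝ) < q' := by exact_mod_cast hq'
  refine ext_nonneg fun r hr => ?_
  rw [lt_pow_of_pos _ (mul_pos hq hq') hr, lt_pow_of_pos _ hq' hr, NNRat.cast_mul]
  apply le_antisymm
  · refine iSup_le fun s => iSup_le fun ⟨hs, h⟩ => ?_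
    have hs' : (0 : ℝ) ≤ s := by exact_mod_cast hs.le
    rw [Real.rpow_mul hs'] at h
    obtain ⟨w, hw, h1, h2⟩ := exists_rat_lt_rpow (by exact_mod_cast hr)
      (Real.rpow_nonneg hs' _) hp' h
    refine le_iSup_of_le w (le_iSup_of_le ⟨hw, h2⟩ ?_)
    rw [lt_pow_of_pos _ hq hw.le]
    exact le_iSup_of_le s (le_iSup_of_le ⟨hs, h1⟩ le_rfl)
  · refine iSup_le fun w => iSup_le fun ⟨hw, h⟩ => ?_
    rw [lt_pow_of_pos _ hq hw.le]
    refine iSup_le fun s => iSup_le fun ⟨hs, h1⟩ => ?_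
    refine le_iSup_of_le s (le_iSup_of_le ⟨hs, ?_⟩ le_rfl)
    rw [Real.rpow_mul (by exact_mod_cast hs.le)]
    exact h.trans (Real.rpow_lt_rpow (by exact_mod_cast hw.le) h1 hp')

theorem mul_pow (x y : NNLower H) (q : ℚ≥0) : (x * y) ^ q = x ^ q * y ^ q := by
  rcases eq_zero_or_pos q with rfl | hq
  · rw [pow_zero, pow_zero, pow_zero, one_mul]
  have hp : (0 : ℝ) < q := by exact_mod_cast hq
  refine ext_nonneg fun r hr => ?_
  rw [lt_pow_of_pos _ hq hr, lt_mul_of_nonneg _ _ hr]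
  apply le_antisymm
  · refine iSup_le fun w => iSup_le fun ⟨hw, h⟩ => ?_
    rw [lt_mul_of_nonneg _ _ hw.le]
    refine iSup_le fun s => iSup_le fun t => iSup_le fun ⟨hs, ht, hst⟩ => ?_
    have hw0 : (0 : ℝ) ≤ w := by exact_mod_cast hw.le
    have hs0 : (0 : ℝ) ≤ s := by exact_mod_cast hs.le
    have ht0 : (0 : ℝ) ≤ t := by exact_mod_cast ht.le
    have h' : (r : ℝ) < (s : ℝ) ^ (q : ℝ) * (t : ℝ) ^ (q : ℝ) := by
      rw [← Real.mul_rpow hs0 ht0]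
      exact h.trans (Real.rpow_lt_rpow hw0 (by exact_mod_cast hst) hp)
    -- The real powers of `s` and `t` are replaced by rationals `a` and `b` below them whose product
    -- still exceeds `r`.
    obtain ⟨a, b, ha, hb, h1, h2, h3⟩ := exists_rat_lt_mul (by exact_mod_cast hr)
      (Real.rpow_nonneg ht0 _) h'
    refine le_iSup_of_le a (le_iSup_of_le b (le_iSup_of_le
      ⟨ha, hb, by exact_mod_cast h3⟩ (inf_le_inf ?_ ?_)))
    · rw [lt_pow_of_pos _ hq ha.le]
      exact le_iSup_of_le s (le_iSup_of_le ⟨hs, h1⟩ le_rfl)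
    · rw [lt_pow_of_pos _ hq hb.le]
      exact le_iSup_of_le t (le_iSup_of_le ⟨ht, h2⟩ le_rfl)
  · refine iSup_le fun a => iSup_le fun b => iSup_le fun ⟨ha, hb, h⟩ => ?_
    rw [lt_pow_of_pos _ hq ha.le, lt_pow_of_pos _ hq hb.le]
    simp only [inf_iSup_eq, iSup_inf_eq]
    refine iSup_le fun t => iSup_le fun ⟨ht, h2⟩ => iSup_le fun s => iSup_le fun ⟨hs, h1⟩ => ?_
    have hb0 : (0 : ℝ) ≤ b := by exact_mod_cast hb.le
    have hs0 : (0 : ℝ) ≤ s := by exact_mod_cast hs.le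
    have ht0 : (0 : ℝ) ≤ t := by exact_mod_cast ht.le
    have h' : (r : ℝ) < ((s : ℝ) * t) ^ (q : ℝ) := by
      rw [Real.mul_rpow hs0 ht0]
      calc (r : ℝ) < a * b := by exact_mod_cast h
        _ ≤ _ := mul_le_mul h1.le h2.le hb0 (Real.rpow_nonneg hs0 _)
    -- The product `s * t` itself cannot be the index, as it must be strictly above it; a slightly
    -- smaller `w` still has `r < w^q`.
    obtain ⟨w, hw, h3, h4⟩ := exists_rat_lt_rpow (by exact_mod_cast hr)
      (mul_nonneg hs0 ht0) hp h'
    refine le_iSup_of_le w (le_iSup_of_le ⟨hw, h4⟩ ?_)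
    rw [lt_mul_of_nonneg _ _ hw.le]
    exact le_iSup_of_le s (le_iSup_of_le t (le_iSup_of_le
      ⟨hs, ht, by exact_mod_cast h3⟩ le_rfl))

/-- The formula `lt_pow` builds the power from values of `x` by joins and `⊤` alone, over index sets
independent of the frame. -/
theorem map_pow (f : FrameHom H K) (x : NNLower H) (q : ℚ≥0) : (x ^ q).map f = (x.map f) ^ q :=
  ext_nonneg fun r hr => by
    change f ((x ^ q).lt r) = _
    rw [lt_pow _ _ hr, lt_pow _ _ hr]
    simp only [below, map, map_iSup, map_sup, map_top]

theorem basicEquations : BasicEquations (NNLower H) :=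
  ⟨pow_add, pow_zero, pow_mul, pow_one, mul_pow, one_pow⟩

end NNLower

/-! ### Upper reals -/

namespace NNUpper

variable {H : Type u} [Order.Frame H] {K : Type v} [Order.Frame K]

theorem ext_pos {x y : NNUpper H} (h : ∀ r, 0 < r → x.gt r = y.gt r) : x = y := by
  ext r
  rcases le_or_gt r 0 with hr | hr
  · rw [x.gt_nonpos hr, y.gt_nonpos hr]
  · exact h r hr

theorem gt_mul (x y : NNUpper H) (r : ℚ) : (x * y).gt r =
    ⨆ (s : ℚ) (t : ℚ) (_ : s * t < r), x.gt s ⊓ y.gt t := rfl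

theorem gt_one (r : ℚ) : (1 : NNUpper H).gt r = ⨆ (_ : 1 < r), ⊤ := rfl

/-- No non-positive rational lies above a non-negative upper real, so indices with `s ≤ 0` or `t ≤
0` contribute `⊥`. -/
theorem gt_mul_eq_iSup_pos (x y : NNUpper H) (r : ℚ) : (x * y).gt r =
    ⨆ (s : ℚ) (t : ℚ) (_ : 0 < s ∧ 0 < t ∧ s * t < r), x.gt s ⊓ y.gt t := by
  rw [gt_mul]
  refine iSup_congr fun s => iSup_congr fun t => ?_
  rcases le_or_gt s 0 with hs | hs
  · simp [x.gt_nonpos hs]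
  rcases le_or_gt t 0 with ht | ht
  · simp [y.gt_nonpos ht]
  simp [hs, ht]

/-- The power is determined by the real number `a / b`. -/
theorem gt_root_natPow (x : NNUpper H) (a : ℕ) (b : ℕ+) {r : ℚ} (hr : 0 < r) :
    ((x.natPow a).root b).gt r =
      (⨆ (s : ℚ) (_ : 0 < s ∧ (s : ℝ) ^ ((a : ℝ) / (b : ℕ)) < (r : ℝ)), x.gt s) ⊔
        ⨆ (_ : (a : ℝ) / (b : ℕ) = 0 ∧ 1 < r), ⊤ := by
  change (⨆ (_ : 0 < r), (x.natPow a).gt (r ^ (b : ℕ))) = _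
  rw [iSup_pos hr]
  change (⨆ (s : ℚ) (_ : 0 < s ∧ s ^ a < r ^ (b : ℕ)), x.gt s) ⊔
    (⨆ (_ : a = 0 ∧ 1 < r ^ (b : ℕ)), ⊤) = _
  congr 1
  · exact iSup_congr fun s => iSup_congr_Prop
      (and_congr_right fun hs => (rpow_natCast_div_lt_iff hr.le hs.le a b).symm) fun _ => rfl
  -- The term for `s = ∞` also depends only on `a / b`: it is present exactly when `a / b = 0`, and
  -- `1 < r^b` amounts to `1 < r`.
  · refine iSup_congr_Prop (and_congr ?_ (one_lt_pow_iff_of_nonneg hr.le b.ne_zero)) fun _ => rfl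
    rw [div_eq_zero_iff]
    simp

theorem root_natPow_congr (x : NNUpper H) {a c : ℕ} {b d : ℕ+}
    (h : (a : ℚ≥0) / ((b : ℕ) : ℚ≥0) = (c : ℚ≥0) / ((d : ℕ) : ℚ≥0)) :
    (x.natPow a).root b = (x.natPow c).root d :=
  ext_pos fun r hr => by
    rw [gt_root_natPow x a b hr, gt_root_natPow x c d hr, natCast_div_real_eq h]

theorem pow_div (x : NNUpper H) (a : ℕ) (b : ℕ+) :
    x ^ ((a : ℚ≥0) / ((b : ℕ) : ℚ≥0)) = (x.natPow a).root b :=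
  root_natPow_congr x (NNRat.num_div_den _)

theorem gt_pow (x : NNUpper H) (q : ℚ≥0) {r : ℚ} (hr : 0 < r) :
    (x ^ q).gt r = (⨆ (s : ℚ) (_ : 0 < s ∧ (s : ℝ) ^ (q : ℝ) < (r : ℝ)), x.gt s) ⊔
      ⨆ (_ : (q : ℝ) = 0 ∧ 1 < r), ⊤ := by
  have h : (q : ℝ) = (q.num : ℝ) / ((⟨q.den, q.den_pos⟩ : ℕ+) : ℕ) := NNRat.cast_def q
  rw [h]
  exact gt_root_natPow x _ _ hr

theorem gt_pow_of_pos (x : NNUpper H) {q : ℚ≥0} (hq : 0 < q) {r : ℚ} (hr : 0 < r) :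
    (x ^ q).gt r = ⨆ (s : ℚ) (_ : 0 < s ∧ (s : ℝ) ^ (q : ℝ) < (r : ℝ)), x.gt s := by
  have hq' : (q : ℝ) ≠ 0 := by exact_mod_cast hq.ne'
  rw [gt_pow x q hr, iSup_neg fun h => hq' h.1, sup_bot_eq]

theorem pow_zero (x : NNUpper H) : x ^ (0 : ℚ≥0) = 1 :=
  ext_pos fun r hr => by
    rw [gt_pow x 0 hr, gt_one]
    -- When `1 < r` the term for `s = ∞` alone gives `⊤`, even if no rational lies above `x`;
    -- otherwise no index survives, because `s^0 = 1`.
    by_cases h : 1 < r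
    · simp [h]
    · have h' : ¬ (1 : ℝ) < r := by exact_mod_cast h
      simp [h, h']

theorem pow_one (x : NNUpper H) : x ^ (1 : ℚ≥0) = x :=
  ext_pos fun r hr => by
    rw [gt_pow_of_pos x one_pos hr]
    conv_rhs => rw [x.rounded r]
    refine iSup_congr fun s => ?_
    rcases le_or_gt s 0 with hs | hs
    · simp [x.gt_nonpos hs]
    · simp [hs]

theorem one_mul (x : NNUpper H) : 1 * x = x :=
  ext_pos fun r hr => by
    rw [gt_mul_eq_iSup_pos]
    apply le_antisymm
    · refine iSup_le fun s => iSup_le fun t => iSup_le fun ⟨hs, ht, h⟩ => ?_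
      rw [gt_one]
      by_cases h1 : 1 < s
      · exact inf_le_right.trans (x.gt_mono ((le_mul_of_one_le_left ht.le h1.le).trans h.le))
      · simp [h1]
    · conv_lhs => rw [x.rounded r]
      refine iSup_le fun t => iSup_le fun h => ?_
      rcases le_or_gt t 0 with ht | ht
      · simp [x.gt_nonpos ht]
      -- Here `t < r` lies above `x`, so a factor `s` fits with `1 < s < r / t`.
      obtain ⟨s, h1, h2⟩ := exists_between ((one_lt_div ht).2 h)
      refine le_iSup_of_le s (le_iSup_of_le t (le_iSup_of_le
        ⟨one_pos.trans h1, ht, (lt_div_iff₀ ht).1 h2⟩ ?_))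
      rw [gt_one, iSup_pos h1, top_inf_eq]

theorem mul_comm (x y : NNUpper H) : x * y = y * x := by
  ext r
  rw [gt_mul, gt_mul, iSup_comm]
  refine iSup_congr fun s => iSup_congr fun t => iSup_congr_Prop ?_ fun _ => inf_comm _ _
  rw [_root_.mul_comm t s]

theorem one_pow (q : ℚ≥0) : (1 : NNUpper H) ^ q = 1 := by
  rcases eq_zero_or_pos q with rfl | hq
  · exact pow_zero 1
  have hq' : (0 : ℝ) < q := by exact_mod_cast hq
  refine ext_pos fun r hr => ?_
  rw [gt_pow_of_pos _ hq hr]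
  apply le_antisymm
  · refine iSup_le fun s => iSup_le fun ⟨hs, h⟩ => iSup_le fun h1 => ?_
    have : (1 : ℝ) < r := (Real.one_le_rpow (by exact_mod_cast h1.le) hq'.le).trans_lt h
    exact le_iSup_of_le (by exact_mod_cast this) le_rfl
  · refine iSup_le fun h => ?_
    obtain ⟨w, hw, h1, h2⟩ := exists_rat_rpow_lt (r := r) (y := 1) zero_le_one hq'
      (by rw [Real.one_rpow]; exact_mod_cast h)
    exact le_iSup_of_le w (le_iSup_of_le ⟨hw, h2⟩
      (le_iSup_of_le (by exact_mod_cast h1) le_rfl))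

theorem pow_add (x : NNUpper H) (q q' : ℚ≥0) : x ^ (q + q') = x ^ q * x ^ q' := by
  rcases eq_zero_or_pos q with rfl | hq
  · rw [zero_add, pow_zero, one_mul]
  rcases eq_zero_or_pos q' with rfl | hq'
  · rw [add_zero, pow_zero, mul_comm, one_mul]
  have hp : (0 : ℝ) < q := by exact_mod_cast hq
  have hp' : (0 : ℝ) < q' := by exact_mod_cast hq'
  refine ext_pos fun r hr => ?_
  rw [gt_pow_of_pos _ (add_pos hq hq') hr, gt_mul_eq_iSup_pos, NNRat.cast_add]
  apply le_antisymm
  · refine iSup_le fun s => iSup_le fun ⟨hs, h⟩ => ?_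
    have hs' : (0 : ℝ) < s := by exact_mod_cast hs
    rw [Real.rpow_add hs'] at h
    obtain ⟨w, w', h1, h2, h3⟩ := exists_rat_mul_lt
      (Real.rpow_pos_of_pos hs' _) (Real.rpow_pos_of_pos hs' _) h
    -- Positivity of the interpolated rationals is automatic, as they lie above powers of a positive
    -- `s`.
    have hw : 0 < w := by exact_mod_cast (Real.rpow_pos_of_pos hs' _).trans h1
    have hw' : 0 < w' := by exact_mod_cast (Real.rpow_pos_of_pos hs' _).trans h2
    refine le_iSup_of_le w (le_iSup_of_le w' (le_iSup_of_le
      ⟨hw, hw', by exact_mod_cast h3⟩ (le_inf ?_ ?_)))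
    · rw [gt_pow_of_pos _ hq hw]
      exact le_iSup_of_le s (le_iSup_of_le ⟨hs, h1⟩ le_rfl)
    · rw [gt_pow_of_pos _ hq' hw']
      exact le_iSup_of_le s (le_iSup_of_le ⟨hs, h2⟩ le_rfl)
  · refine iSup_le fun w => iSup_le fun w' => iSup_le fun ⟨hw, hw', h⟩ => ?_
    rw [gt_pow_of_pos _ hq hw, gt_pow_of_pos _ hq' hw']
    simp only [inf_iSup_eq, iSup_inf_eq]
    refine iSup_le fun t => iSup_le fun ⟨ht, h2⟩ => iSup_le fun s => iSup_le fun ⟨hs, h1⟩ => ?_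
    have hw0 : (0 : ℝ) ≤ w := by exact_mod_cast hw.le
    have hm : (0 : ℝ) < (min s t : ℚ) := by exact_mod_cast lt_min hs ht
    have hsm : ((min s t : ℚ) : ℝ) ≤ s := by exact_mod_cast min_le_left s t
    have htm : ((min s t : ℚ) : ℝ) ≤ t := by exact_mod_cast min_le_right s t
    -- Dually to lower reals, the smaller witness serves for both factors: it is still above `x` and
    -- its powers are at most those of `s` and `t`.
    refine le_iSup_of_le (min s t) (le_iSup_of_le ⟨lt_min hs ht, ?_⟩ ?_)
    · rw [Real.rpow_add hm]
      calc _ ≤ (w : ℝ) * w' := mul_le_mul ((Real.rpow_le_rpow hm.le hsm hp.le).trans h1.le)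
            ((Real.rpow_le_rpow hm.le htm hp'.le).trans h2.le) (Real.rpow_nonneg hm.le _) hw0
        _ < r := by exact_mod_cast h
    · rcases min_choice s t with e | e <;> rw [e]
      · exact inf_le_left
      · exact inf_le_right

theorem pow_mul (x : NNUpper H) (q q' : ℚ≥0) : x ^ (q * q') = (x ^ q) ^ q' := by
  rcases eq_zero_or_pos q with rfl | hq
  · rw [zero_mul, pow_zero, one_pow]
  rcases eq_zero_or_pos q' with rfl | hq'
  · rw [mul_zero, pow_zero, pow_zero]
  have hp' : (0 : ℝ) < q' := by exact_mod_cast hq'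
  refine ext_pos fun r hr => ?_
  rw [gt_pow_of_pos _ (mul_pos hq hq') hr, gt_pow_of_pos _ hq' hr, NNRat.cast_mul]
  apply le_antisymm
  · refine iSup_le fun s => iSup_le fun ⟨hs, h⟩ => ?_
    have hs' : (0 : ℝ) ≤ s := by exact_mod_cast hs.le
    rw [Real.rpow_mul hs'] at h
    obtain ⟨w, hw, h1, h2⟩ := exists_rat_rpow_lt (Real.rpow_nonneg hs' _) hp' h
    refine le_iSup_of_le w (le_iSup_of_le ⟨hw, h2⟩ ?_)
    rw [gt_pow_of_pos _ hq hw]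
    exact le_iSup_of_le s (le_iSup_of_le ⟨hs, h1⟩ le_rfl)
  · refine iSup_le fun w => iSup_le fun ⟨hw, h⟩ => ?_
    rw [gt_pow_of_pos _ hq hw]
    refine iSup_le fun s => iSup_le fun ⟨hs, h1⟩ => ?_
    have hs' : (0 : ℝ) ≤ s := by exact_mod_cast hs.le
    refine le_iSup_of_le s (le_iSup_of_le ⟨hs, ?_⟩ le_rfl)
    rw [Real.rpow_mul hs']
    exact (Real.rpow_lt_rpow (Real.rpow_nonneg hs' _) h1 hp').trans h

theorem mul_pow (x y : NNUpper H) (q : ℚ≥0) : (x * y) ^ q = x ^ q * y ^ q := by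
  rcases eq_zero_or_pos q with rfl | hq
  · rw [pow_zero, pow_zero, pow_zero, one_mul]
  have hp : (0 : ℝ) < q := by exact_mod_cast hq
  refine ext_pos fun r hr => ?_
  rw [gt_pow_of_pos _ hq hr, gt_mul_eq_iSup_pos]
  apply le_antisymm
  · refine iSup_le fun w => iSup_le fun ⟨hw, h⟩ => ?_
    rw [gt_mul_eq_iSup_pos]
    refine iSup_le fun s => iSup_le fun t => iSup_le fun ⟨hs, ht, hst⟩ => ?_
    have hs0 : (0 : ℝ) < s := by exact_mod_cast hs
    have ht0 : (0 : ℝ) < t := by exact_mod_cast ht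
    have h' : (s : ℝ) ^ (q : ℝ) * (t : ℝ) ^ (q : ℝ) < r := by
      rw [← Real.mul_rpow hs0.le ht0.le]
      exact (Real.rpow_lt_rpow (mul_pos hs0 ht0).le (by exact_mod_cast hst) hp).trans h
    obtain ⟨a, b, h1, h2, h3⟩ := exists_rat_mul_lt
      (Real.rpow_pos_of_pos hs0 _) (Real.rpow_pos_of_pos ht0 _) h'
    have ha : 0 < a := by exact_mod_cast (Real.rpow_pos_of_pos hs0 _).trans h1
    have hb : 0 < b := by exact_mod_cast (Real.rpow_pos_of_pos ht0 _).trans h2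
    refine le_iSup_of_le a (le_iSup_of_le b (le_iSup_of_le
      ⟨ha, hb, by exact_mod_cast h3⟩ (inf_le_inf ?_ ?_)))
    · rw [gt_pow_of_pos _ hq ha]
      exact le_iSup_of_le s (le_iSup_of_le ⟨hs, h1⟩ le_rfl)
    · rw [gt_pow_of_pos _ hq hb]
      exact le_iSup_of_le t (le_iSup_of_le ⟨ht, h2⟩ le_rfl)
  · refine iSup_le fun a => iSup_le fun b => iSup_le fun ⟨ha, hb, h⟩ => ?_
    rw [gt_pow_of_pos _ hq ha, gt_pow_of_pos _ hq hb]
    simp only [inf_iSup_eq, iSup_inf_eq]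
    refine iSup_le fun t => iSup_le fun ⟨ht, h2⟩ => iSup_le fun s => iSup_le fun ⟨hs, h1⟩ => ?_
    have ha0 : (0 : ℝ) ≤ a := by exact_mod_cast ha.le
    have hs0 : (0 : ℝ) ≤ s := by exact_mod_cast hs.le
    have ht0 : (0 : ℝ) ≤ t := by exact_mod_cast ht.le
    have h' : ((s : ℝ) * t) ^ (q : ℝ) < r := by
      rw [Real.mul_rpow hs0 ht0]
      calc _ ≤ (a : ℝ) * b := mul_le_mul h1.le h2.le (Real.rpow_nonneg ht0 _) ha0
        _ < r := by exact_mod_cast h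
    -- The index must be strictly above `s * t`, so a slightly larger `w` is chosen that still has
    -- `w^q < r`.
    obtain ⟨w, hw, h3, h4⟩ := exists_rat_rpow_lt (mul_nonneg hs0 ht0) hp h'
    refine le_iSup_of_le w (le_iSup_of_le ⟨hw, h4⟩ ?_)
    rw [gt_mul_eq_iSup_pos]
    exact le_iSup_of_le s (le_iSup_of_le t (le_iSup_of_le
      ⟨hs, ht, by exact_mod_cast h3⟩ le_rfl))

theorem map_pow (f : FrameHom H K) (x : NNUpper H) (q : ℚ≥0) : (x ^ q).map f = (x.map f) ^ q :=
  ext_pos fun r hr => by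
    change f ((x ^ q).gt r) = _
    rw [gt_pow _ _ hr, gt_pow _ _ hr]
    simp only [map, map_iSup, map_sup, map_top]

theorem basicEquations : BasicEquations (NNUpper H) :=
  ⟨pow_add, pow_zero, pow_mul, pow_one, mul_pow, one_pow⟩

end NNUpper

/-! ### Dedekind reals -/

namespace NNDedekind

variable {H : Type u} [Order.Frame H] {K : Type v} [Order.Frame K]

theorem root_natPow_congr (x : NNDedekind H) {a c : ℕ} {b d : ℕ+}
    (h : (a : ℚ≥0) / ((b : ℕ) : ℚ≥0) = (c : ℚ≥0) / ((d : ℕ) : ℚ≥0)) :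
    (x.natPow a).root b = (x.natPow c).root d :=
  NNDedekind.ext (x.lower.root_natPow_congr h) (x.upper.root_natPow_congr h)

theorem pow_div (x : NNDedekind H) (a : ℕ) (b : ℕ+) :
    x ^ ((a : ℚ≥0) / ((b : ℕ) : ℚ≥0)) = (x.natPow a).root b :=
  NNDedekind.ext (x.lower.pow_div a b) (x.upper.pow_div a b)

theorem map_pow (f : FrameHom H K) (x : NNDedekind H) (q : ℚ≥0) :
    (x ^ q).map f = (x.map f) ^ q :=
  NNDedekind.ext (x.lower.map_pow f q) (x.upper.map_pow f q)

/-- A Dedekind real is determined by its two sections, and all operations act on these separately by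
definition. That the results are again inhabited, separated and located is part of the definitions
of the operations, so only the laws for each section remain. -/
theorem basicEquations : BasicEquations (NNDedekind H) where
  pow_add x q q' := NNDedekind.ext (x.lower.pow_add q q') (x.upper.pow_add q q')
  pow_zero x := NNDedekind.ext x.lower.pow_zero x.upper.pow_zero
  pow_mul x q q' := NNDedekind.ext (x.lower.pow_mul q q') (x.upper.pow_mul q q')
  pow_one x := NNDedekind.ext x.lower.pow_one x.upper.pow_one
  mul_pow x y q := NNDedekind.ext (x.lower.mul_pow y.lower q) (x.upper.mul_pow y.upper q)
  one_pow q := NNDedekind.ext (NNLower.one_pow q) (NNUpper.one_pow q)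

end NNDedekind

end PointFree

theorem mainTheorem9 (H : Type*) [Order.Frame H] (K : Type*) [Order.Frame K] :
    -- lower reals: independence of the representation, Basic Equations, geometricity
    ((∀ (x : PointFree.NNLower H) (a c : ℕ) (b d : ℕ+),
        (a : ℚ≥0) / ((b : ℕ) : ℚ≥0) = (c : ℚ≥0) / ((d : ℕ) : ℚ≥0) →
          (x.natPow a).root b = (x.natPow c).root d) ∧
      (∀ (x : PointFree.NNLower H) (a : ℕ) (b : ℕ+),
        x ^ ((a : ℚ≥0) / ((b : ℕ) : ℚ≥0)) = (x.natPow a).root b) ∧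
      PointFree.BasicEquations (PointFree.NNLower H) ∧
      (∀ (f : FrameHom H K) (x : PointFree.NNLower H) (q : ℚ≥0),
        (x ^ q).map f = (x.map f) ^ q)) ∧
    -- upper reals
    ((∀ (x : PointFree.NNUpper H) (a c : ℕ) (b d : ℕ+),
        (a : ℚ≥0) / ((b : ℕ) : ℚ≥0) = (c : ℚ≥0) / ((d : ℕ) : ℚ≥0) →
          (x.natPow a).root b = (x.natPow c).root d) ∧
      (∀ (x : PointFree.NNUpper H) (a : ℕ) (b : ℕ+),
        x ^ ((a : ℚ≥0) / ((b : ℕ) : ℚ≥0)) = (x.natPow a).root b) ∧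
      PointFree.BasicEquations (PointFree.NNUpper H) ∧
      (∀ (f : FrameHom H K) (x : PointFree.NNUpper H) (q : ℚ≥0),
        (x ^ q).map f = (x.map f) ^ q)) ∧
    -- Dedekind reals
    ((∀ (x : PointFree.NNDedekind H) (a c : ℕ) (b d : ℕ+),
        (a : ℚ≥0) / ((b : ℕ) : ℚ≥0) = (c : ℚ≥0) / ((d : ℕ) : ℚ≥0) →
          (x.natPow a).root b = (x.natPow c).root d) ∧
      (∀ (x : PointFree.NNDedekind H) (a : ℕ) (b : ℕ+),
        x ^ ((a : ℚ≥0) / ((b : ℕ) : ℚ≥0)) = (x.natPow a).root b) ∧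
      PointFree.BasicEquations (PointFree.NNDedekind H) ∧
      (∀ (f : FrameHom H K) (x : PointFree.NNDedekind H) (q : ℚ≥0),
        (x ^ q).map f = (x.map f) ^ q)) :=
  ⟨⟨fun x _ _ _ _ h => x.root_natPow_congr h, fun x => x.pow_div,
      PointFree.NNLower.basicEquations, fun f x => x.map_pow f⟩,
    ⟨fun x _ _ _ _ h => x.root_natPow_congr h, fun x => x.pow_div,
      PointFree.NNUpper.basicEquations, fun f x => x.map_pow f⟩,
    ⟨fun x _ _ _ _ h => x.root_natPow_congr h, fun x => x.pow_div,
      PointFree.NNDedekind.basicEquations, fun f x => x.map_pow f⟩⟩
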